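/- **Theorem.** A representation of a C\*-algebra is a \*-homomorphism into the bounded operators $B(H)$ on a complex Hilbert space $H$; a state is a positive linear functional of norm one; a projection is a self-adjoint idempotent. Let $\mathcal A$ be a C\*-algebra (with or without unit) and let $\rho$ be a faithful non-degenerate representation of $\mathcal A$ on a Hilbert space $H$. For a representation $\pi$ of $\mathcal A$ on a Hilbert space $H_1$ and a projection $P\in B(H_1)$, say that $(\pi,P)$ *induces the norm distance* if for every pair of states $\phi,\psi$ on $\mathcal A$ $$\|\phi-\psi\| \;=\; \sup\{\,|(\phi-\psi)(a)| \;:\; a=a^*\in\mathcal A,\ \|[P,\pi(a)]\|\le 1\,\}.$$ 1. Let $H_1=H\otimes H$ be the Hilbert space tensor product, let $\pi(a)=\rho(a)\otimes I$ be the amplification of $\rho$ to $H_1$, and let $S$ be the flip on $H_1$, $S(\xi\otimes\eta)=\eta\otimes\xi$. Then $P=\tfrac12(I+S)$ is a projection and $(\pi,P)$ induces the norm distance. 2. If $H$ is separable and the commutant $\rho(\mathcal A)'$ is a properly infinite von Neumann algebra (every non-zero central projection of it is Murray–von Neumann equivalent in $\rho(\mathcal A)'$ to a proper subprojection of itself),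 then there is a projection $P\in B(H)$ such that $(\rho,P)$ induces the norm distance. 3. Let $n\ge1$, let $\mathcal A=M_n(\mathbb C)$, and let $\rho$ be the standard representation of $M_n(\mathbb C)$ by left multiplication on $L^2(M_n,\tfrac1n\mathrm{tr})$, the space of $n\times n$ matrices with inner product $\langle x,y\rangle=\tfrac1n\mathrm{tr}(x^*y)$ (conjugate-linear in $x$). Let $T$ be the transposition $x\mapsto x^{T}$ on this space. Then $P=\tfrac12(I+T)$ is a projection and $(\rho,P)$ induces the norm distance. -/

import Mathlib

open scoped TensorProduct InnerProductSpace ComplexOrder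

universe u v w

namespace UniformMetric

section General

variable {A : Type u} [NonUnitalCStarAlgebra A]
variable {H : Type v} [NormedAddCommGroup H] [InnerProductSpace ℂ H] [CompleteSpace H]

/-- A state on a (not necessarily unital) C⋆-algebra: a positive linear functional of norm one. -/
def IsState (φ : StrongDual ℂ A) : Prop :=
  (∀ a : A, 0 ≤ φ (star a * a)) ∧ ‖φ‖ = 1

/-- A representation is non-degenerate when the vectors `ρ a ξ` span a dense subspace. -/
def IsNondegenerate (ρ : A →⋆ₙₐ[ℂ] (H →L[ℂ] H)) : Prop :=
  Dense (Submodule.span ℂ {x : H | ∃ (a : A) (ξ : H), ρ a ξ = x} : Set H)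

/-- The numbers `|(φ - ψ)(a)|` with `a = a⋆` and `‖[P, π a]‖ ≤ 1`. Their supremum is the distance
between `φ` and `ψ` in which `P` plays the role of the Dirac operator. -/
def distanceSet (π : A →⋆ₙₐ[ℂ] (H →L[ℂ] H)) (P : H →L[ℂ] H) (φ ψ : StrongDual ℂ A) : Set ℝ :=
  {r : ℝ | ∃ a : A, IsSelfAdjoint a ∧ ‖P * π a - π a * P‖ ≤ 1 ∧ r = ‖(φ - ψ) a‖}

/-- The metric on the state space given by `π` and `P` is the norm distance. -/
def InducesNormDistance (π : A →⋆ₙₐ[ℂ] (H →L[ℂ] H)) (P : H →L[ℂ] H) : Prop :=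
  ∀ φ ψ : StrongDual ℂ A, IsState φ → IsState ψ → IsLUB (distanceSet π P φ ψ) ‖φ - ψ‖

/-- The commutant `ρ(A)'` of the image of a representation, as a von Neumann algebra. -/
noncomputable def repCommutant (ρ : A →⋆ₙₐ[ℂ] (H →L[ℂ] H)) : VonNeumannAlgebra H where
  toStarSubalgebra := StarSubalgebra.centralizer ℂ (Set.range ρ)
  centralizer_centralizer' := by simp

/-- As `ρ(A)` is closed under the adjoint, `repCommutant ρ` is the plain commutant. -/
theorem mem_repCommutant_iff (ρ : A →⋆ₙₐ[ℂ] (H →L[ℂ] H)) (x : H →L[ℂ] H) :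
    x ∈ repCommutant ρ ↔ ∀ a : A, ρ a * x = x * ρ a := by
  change x ∈ StarSubalgebra.centralizer ℂ (Set.range ρ) ↔ _
  rw [StarSubalgebra.mem_centralizer_iff]
  constructor
  · intro h a
    exact (h _ ⟨a, rfl⟩).1
  · rintro h _ ⟨a, rfl⟩
    refine ⟨h a, ?_⟩
    rw [← map_star]
    exact h (star a)

/-- Murray–von Neumann equivalence of projections relative to `M`. -/
def MvNEquiv (M : VonNeumannAlgebra H) (p q : H →L[ℂ] H) : Prop :=
  ∃ v ∈ M, star v * v = p ∧ v * star v = q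

/-- A projection `p` of `M` is infinite when it is equivalent in `M` to a projection `q` of `M`
with `q ≤ p` and `q ≠ p`. -/
def IsInfiniteProj (M : VonNeumannAlgebra H) (p : H →L[ℂ] H) : Prop :=
  ∃ q ∈ M, IsStarProjection q ∧ p * q = q ∧ q ≠ p ∧ MvNEquiv M p q

/-- `M` is properly infinite when every non-zero central projection of `M` is infinite. -/
def IsProperlyInfinite (M : VonNeumannAlgebra H) : Prop :=
  ∀ z ∈ M, IsStarProjection z → (∀ x ∈ M, z * x = x * z) → z ≠ 0 → IsInfiniteProj M z

end General

section Tensor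

variable (H : Type v) [NormedAddCommGroup H] [InnerProductSpace ℂ H]
variable (K : Type w) [NormedAddCommGroup K] [InnerProductSpace ℂ K]

/-- The Hilbert space tensor product: the completion of the algebraic tensor product in the inner
product with `⟪ξ ⊗ η, ξ' ⊗ η'⟫ = ⟪ξ, ξ'⟫ * ⟪η, η'⟫`. -/
abbrev HilbertTensor : Type (max v w) := UniformSpace.Completion (H ⊗[ℂ] K)

variable {H K}

/-- The elementary tensor `ξ ⊗ η` in the Hilbert space tensor product. -/
noncomputable def htmul (ξ : H) (η : K) : HilbertTensor H K := ((ξ ⊗ₜ[ℂ] η : H ⊗[ℂ] K) :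
  UniformSpace.Completion (H ⊗[ℂ] K))

/-- `π` is the amplification `a ↦ ρ a ⊗ I` of `ρ` to `H ⊗ K` (a bounded operator is determined by
its values on elementary tensors, so there is at most one such `π`). -/
def IsAmplification {A : Type u} [NonUnitalCStarAlgebra A] [CompleteSpace H]
    (ρ : A →⋆ₙₐ[ℂ] (H →L[ℂ] H))
    (π : A →⋆ₙₐ[ℂ] (HilbertTensor H K →L[ℂ] HilbertTensor H K)) : Prop :=
  ∀ (a : A) (ξ : H) (η : K), π a (htmul ξ η) = htmul (ρ a ξ) η

/-- `S` is the flip `ξ ⊗ η ↦ η ⊗ ξ` on `H ⊗ H`. -/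
def IsFlip (S : HilbertTensor H H →L[ℂ] HilbertTensor H H) : Prop :=
  ∀ ξ η : H, S (htmul ξ η) = htmul η ξ

end Tensor

section MatrixAlgebra

/-- The Hilbert space `L²(M_n, tr / n)`: the complex `n × n` matrices with the inner product
`⟪x, y⟫ = tr (xᴴ y) / n`. -/
def MatrixL2 (n : ℕ) : Type := Matrix (Fin n) (Fin n) ℂ

variable (n : ℕ)

instance : AddCommGroup (MatrixL2 n) := inferInstanceAs (AddCommGroup (Matrix (Fin n) (Fin n) ℂ))

instance : Module ℂ (MatrixL2 n) := inferInstanceAs (Module ℂ (Matrix (Fin n) (Fin n) ℂ))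

/-- A matrix viewed as a vector of `L²(M_n, tr / n)`. -/
def toL2 : Matrix (Fin n) (Fin n) ℂ ≃ₗ[ℂ] MatrixL2 n := LinearEquiv.refl ℂ _

instance : FiniteDimensional ℂ (MatrixL2 n) := Module.Finite.equiv (toL2 n)

variable [NeZero n]

/-- The inner product of `L²(M_n, tr / n)`. -/
noncomputable abbrev matrixL2Core : InnerProductSpace.Core ℂ (MatrixL2 n) where
  inner x y := (1 / (n : ℂ)) * (((toL2 n).symm x).conjTranspose * (toL2 n).symm y).trace
  conj_inner_symm x y := by
    simp [starRingEnd_apply, ← Matrix.trace_conjTranspose, Matrix.conjTranspose_mul]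
  re_inner_nonneg x := by
    have h := (Matrix.posSemidef_conjTranspose_mul_self ((toL2 n).symm x)).trace_nonneg
    have hn : (0 : ℂ) ≤ 1 / (n : ℂ) := by
      simp
    exact (Complex.nonneg_iff.mp (mul_nonneg hn h)).1
  add_left x y z := by
    simp [Matrix.conjTranspose_add, add_mul, mul_add]
  smul_left x y r := by
    simp [Matrix.conjTranspose_smul]
    ring
  definite x hx := by
    have hn : (1 / (n : ℂ)) ≠ 0 := by simp [NeZero.ne n]
    have h := (mul_eq_zero.mp hx).resolve_left hn
    rw [Matrix.trace_conjTranspose_mul_self_eq_zero_iff] at h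
    simpa using h

noncomputable instance : NormedAddCommGroup (MatrixL2 n) :=
  (matrixL2Core n).toNormedAddCommGroup

noncomputable instance : InnerProductSpace ℂ (MatrixL2 n) :=
  InnerProductSpace.ofCore (matrixL2Core n).toCore

instance : CompleteSpace (MatrixL2 n) := FiniteDimensional.complete ℂ _

theorem matrixL2_inner (x y : MatrixL2 n) :
    ⟪x, y⟫_ℂ = (1 / (n : ℂ)) * (((toL2 n).symm x).conjTranspose * (toL2 n).symm y).trace := rfl

/-- Left multiplication by a matrix as an operator on `L²(M_n, tr / n)`. -/
noncomputable def leftMul (a : Matrix (Fin n) (Fin n) ℂ) : MatrixL2 n →L[ℂ] MatrixL2 n :=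
  LinearMap.toContinuousLinearMap
    ((toL2 n).toLinearMap ∘ₗ LinearMap.mulLeft ℂ a ∘ₗ (toL2 n).symm.toLinearMap)

theorem leftMul_apply (a : Matrix (Fin n) (Fin n) ℂ) (x : MatrixL2 n) :
    leftMul n a x = toL2 n (a * (toL2 n).symm x) := rfl

/-- The standard representation of the C⋆-algebra `M_n` on `L²(M_n, tr / n)`, by left
multiplication. (`CStarMatrix` carries the C⋆-norm of `M_n`.) -/
noncomputable def standardRep :
    CStarMatrix (Fin n) (Fin n) ℂ →⋆ₙₐ[ℂ] (MatrixL2 n →L[ℂ] MatrixL2 n) where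
  toFun a := leftMul n (CStarMatrix.ofMatrix.symm a)
  map_smul' c a := by
    ext x
    change toL2 n ((c • CStarMatrix.ofMatrix.symm a) * (toL2 n).symm x) = c • _
    rw [Matrix.smul_mul, map_smul]
    rfl
  map_zero' := by
    ext x
    change toL2 n (0 * (toL2 n).symm x) = 0
    rw [Matrix.zero_mul, map_zero]
  map_add' a b := by
    ext x
    change toL2 n ((CStarMatrix.ofMatrix.symm a + CStarMatrix.ofMatrix.symm b) *
      (toL2 n).symm x) = _
    rw [Matrix.add_mul, map_add, add_apply, leftMul_apply, leftMul_apply]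
  map_mul' a b := by
    ext x
    change toL2 n ((CStarMatrix.ofMatrix.symm a * CStarMatrix.ofMatrix.symm b) *
      (toL2 n).symm x) = _
    rw [Matrix.mul_assoc]
    rfl
  map_star' a := by
    rw [ContinuousLinearMap.star_eq_adjoint, ContinuousLinearMap.eq_adjoint_iff]
    intro x y
    rw [matrixL2_inner, matrixL2_inner, leftMul_apply, leftMul_apply]
    change _ * ((Matrix.conjTranspose ((CStarMatrix.ofMatrix.symm a).conjTranspose *
      (toL2 n).symm x)) * _).trace = _
    rw [Matrix.conjTranspose_mul, Matrix.conjTranspose_conjTranspose, Matrix.mul_assoc,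
      LinearEquiv.symm_apply_apply]

/-- The transposition `T` on `L²(M_n, tr / n)`. -/
noncomputable def transposition : MatrixL2 n →L[ℂ] MatrixL2 n :=
  LinearMap.toContinuousLinearMap
    ((toL2 n).toLinearMap ∘ₗ (Matrix.transposeLinearEquiv (Fin n) (Fin n) ℂ ℂ).toLinearMap ∘ₗ
      (toL2 n).symm.toLinearMap)

theorem transposition_apply (x : MatrixL2 n) :
    transposition n x = toL2 n ((toL2 n).symm x).transpose := rfl

end MatrixAlgebra

end UniformMetric

namespace UniformMetric

/-! Everything reduces to one criterion, `inducesNormDistance_of_oscillation`: it suffices that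
`‖[P, π a]‖ ≤ 1` forces the numerical range of `ρ a` to have length at most 2, where `ρ` is faithful
and may differ from `π`. Since `[P, x]` is half the commutator with the symmetry `2P - 1`, `‖[P, x]‖
≤ ‖x‖`; so the self-adjoint unit ball is admissible and the supremum is at least `‖φ - ψ‖`.
Conversely, a numerical range of length at most 2 gives a real `c` with `‖ρ a - c‖ ≤ 1`, and `φ - ψ`
kills constants (in the limit along an approximate unit), so `|(φ - ψ) a| ≤ ‖φ - ψ‖`.

The oscillation is bounded by `re_inner_sub_le_of_commutator`: if `P` fixes `x + y` and kills `x -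
y`, pairing `[P, X](x - y)` with `x + y` gives `⟪x, X x⟫ - ⟪y, X y⟫`. For the flip take `x = ξ ⊗ η`,
`y = η ⊗ ξ`; for the transposition, the rank one matrices `ξ ηᵀ` and `η ξᵀ`.

For a properly infinite commutant, `P` is built by hand. Infinite projections yield sequences of
partial isometries with orthogonal ranges, which leave room to replace countably many vectors by
mutually orthogonal ones with the same functionals on `ρ(A)`
(`IsOrthogonalShiftFamily.exists_disjoint`). After scaling each pair from a countable dense set to
equal norms, `P` projects onto the closed span of the sums of the replaced pairs. -/

/-- `[p, x]` is half of `[s, x]` for the symmetry `s = 2p - 1`, which has norm one; the naive bound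
would lose a factor of 2. -/
theorem norm_commutator_le {B : Type*} [CStarAlgebra B] {p : B} (hp : IsStarProjection p) (x : B) :
    ‖p * x - x * p‖ ≤ ‖x‖ := by
  rcases subsingleton_or_nontrivial B with _ | _
  · simp [Subsingleton.elim (p * x - x * p) 0]
  set s : B := p + p - 1
  have hss : star s * s = 1 := by
    have h1 := hp.isIdempotentElem.eq
    have h2 := hp.isSelfAdjoint.star_eq
    simp only [s, star_sub, star_add, h2, star_one, sub_mul, mul_sub, add_mul, mul_add, h1]
    simp only [one_mul, mul_one]
    abel
  have hs : ‖s‖ = 1 := by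
    have := CStarRing.norm_star_mul_self (x := s)
    rw [hss, CStarRing.norm_one] at this
    nlinarith [norm_nonneg s]
  have h2 : (2 : ℂ) • (p * x - x * p) = s * x - x * s := by
    simp only [s, sub_mul, mul_sub, add_mul, mul_add, two_smul]
    simp only [one_mul, mul_one]
    abel
  have h3 : ‖s * x - x * s‖ ≤ 2 * ‖x‖ := by
    refine (norm_sub_le _ _).trans ?_
    have a1 := norm_mul_le s x
    have a2 := norm_mul_le x s
    rw [hs] at a1 a2
    linarith
  rw [← h2, norm_smul] at h3
  simpa using h3

theorem opNorm_le_of_forall_norm_le_one {E F : Type*} [NormedAddCommGroup E] [NormedSpace ℂ E]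
    [NormedAddCommGroup F] [NormedSpace ℂ F] (f : E →L[ℂ] F) {c : ℝ} (hc : 0 ≤ c)
    (h : ∀ x, ‖x‖ ≤ 1 → ‖f x‖ ≤ c) : ‖f‖ ≤ c := by
  refine f.opNorm_le_bound hc fun x ↦ ?_
  rcases eq_or_ne x 0 with rfl | hx
  · simp
  have hx' : 0 < ‖x‖ := norm_pos_iff.2 hx
  have := h (((‖x‖⁻¹ : ℝ) : ℂ) • x) (by
    rw [norm_smul, Complex.norm_real, norm_inv, norm_norm, inv_mul_cancel₀ hx'.ne'])
  rw [map_smul, norm_smul, Complex.norm_real, norm_inv, norm_norm, inv_mul_le_iff₀ hx'] at this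
  linarith

/-! ### States on non-unital C⋆-algebras -/

section States

variable {A : Type u} [NonUnitalCStarAlgebra A]

theorem nonneg_apply_of_nonneg [PartialOrder A] [StarOrderedRing A] {φ : StrongDual ℂ A}
    (hφ : ∀ a : A, 0 ≤ φ (star a * a)) {a : A} (ha : 0 ≤ a) : 0 ≤ φ a := by
  obtain ⟨b, rfl⟩ := CStarAlgebra.nonneg_iff_eq_star_mul_self.1 ha
  exact hφ b

theorem im_apply_eq_zero {φ : StrongDual ℂ A} (hφ : ∀ a : A, 0 ≤ φ (star a * a)) {a : A}
    (ha : IsSelfAdjoint a) : (φ a).im = 0 := by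
  let _ := CStarAlgebra.spectralOrder A
  have := CStarAlgebra.spectralOrderedRing A
  rw [← CFC.posPart_sub_negPart a ha, map_sub, Complex.sub_im]
  have h1 := (Complex.nonneg_iff.1 (nonneg_apply_of_nonneg hφ (CFC.posPart_nonneg a))).2
  have h2 := (Complex.nonneg_iff.1 (nonneg_apply_of_nonneg hφ (CFC.negPart_nonneg a))).2
  rw [← h1, ← h2, sub_zero]

/-- This is Cauchy–Schwarz for the semi-inner product of the GNS construction. -/
theorem cauchy_schwarz_apply {φ : StrongDual ℂ A} (hφ : ∀ a : A, 0 ≤ φ (star a * a)) (a b : A) :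
    ‖φ (star a * b)‖ ^ 2 ≤ ‖φ (star a * a)‖ * ‖φ (star b * b)‖ := by
  let _ := CStarAlgebra.spectralOrder A
  have := CStarAlgebra.spectralOrderedRing A
  let f : A →ₚ[ℂ] ℂ := PositiveLinearMap.mk₀ φ.toLinearMap
    fun x hx ↦ nonneg_apply_of_nonneg hφ hx
  have h := inner_mul_inner_self_le (𝕜 := ℂ) (f.toPreGNS a) (f.toPreGNS b)
  have key : ∀ x y : A, ⟪f.toPreGNS x, f.toPreGNS y⟫_ℂ = φ (star x * y) := fun x y ↦ rfl
  rw [norm_inner_symm (f.toPreGNS b), key, key, key] at h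
  rw [sq]
  refine h.trans (mul_le_mul (Complex.re_le_norm _) (Complex.re_le_norm _) ?_ (norm_nonneg _))
  exact (Complex.nonneg_iff.1 (hφ b)).1

/-- Substitute for `φ 1 = 1`. If `a` in the unit ball nearly attains `‖φ‖ = 1`, Cauchy–Schwarz gives
`|φ (x a)|² ≤ φ (x x)`, and the left side tends to `|φ a|²`. -/
theorem IsState.tendsto_apply_mul_self [PartialOrder A] [StarOrderedRing A] {φ : StrongDual ℂ A}
    (hφ : IsState φ) :
    Filter.Tendsto (fun x ↦ φ (x * x)) (CStarAlgebra.approximateUnit A) (nhds 1) := by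
  have hl := CStarAlgebra.increasingApproximateUnit A
  have hreal : Filter.Tendsto (fun x ↦ ‖φ (x * x)‖) (CStarAlgebra.approximateUnit A) (nhds 1) := by
    have hle : ∀ᶠ x in CStarAlgebra.approximateUnit A, ‖φ (x * x)‖ ≤ 1 := by
      filter_upwards [hl.eventually_norm] with x hx
      refine (φ.le_opNorm _).trans ?_
      rw [hφ.2, one_mul]
      exact (norm_mul_le x x).trans (mul_le_one₀ hx (norm_nonneg _) hx)
    rw [tendsto_order]
    refine ⟨fun c hc ↦ ?_, fun c hc ↦ hle.mono fun x hx ↦ hx.trans_lt hc⟩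
    set d := max c 0
    have hd : d < 1 := max_lt hc one_pos
    have hd0 : 0 ≤ d := le_max_right _ _
    obtain ⟨a, ha, hda⟩ : ∃ a : A, ‖a‖ ≤ 1 ∧ √d < ‖φ a‖ := by
      by_contra! hcon
      have : ‖φ‖ ≤ √d := opNorm_le_of_forall_norm_le_one φ (Real.sqrt_nonneg _) hcon
      rw [hφ.2] at this
      have h2 : √d < 1 := by rw [Real.sqrt_lt' one_pos]; simpa using hd
      linarith
    have ht : Filter.Tendsto (fun x ↦ ‖φ (x * a)‖) (CStarAlgebra.approximateUnit A)
        (nhds ‖φ a‖) := ((φ.continuous.tendsto a).comp (hl.tendsto_mul_right a)).norm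
    filter_upwards [ht.eventually (lt_mem_nhds hda), hl.eventually_star_eq] with x hx hxs
    have hcs := cauchy_schwarz_apply hφ.1 x a
    rw [hxs] at hcs
    have h3 : ‖φ (star a * a)‖ ≤ 1 := by
      refine (φ.le_opNorm _).trans ?_
      rw [hφ.2, one_mul, CStarRing.norm_star_mul_self]
      exact mul_le_one₀ ha (norm_nonneg _) ha
    have h4 : d < ‖φ (x * a)‖ ^ 2 := by
      rwa [Real.sqrt_lt' ((Real.sqrt_nonneg d).trans_lt hx)] at hx
    refine (le_max_left c 0).trans_lt (h4.trans_le (hcs.trans ?_))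
    exact mul_le_of_le_one_right (norm_nonneg _) h3
  have hev : ∀ᶠ x in CStarAlgebra.approximateUnit A, ((‖φ (x * x)‖ : ℝ) : ℂ) = φ (x * x) := by
    filter_upwards [hl.eventually_star_eq] with x hx
    have := hφ.1 x
    rw [hx] at this
    exact (Complex.eq_coe_norm_of_nonneg this).symm
  have := (Complex.continuous_ofReal.tendsto (1 : ℝ)).comp hreal
  exact (Complex.ofReal_one ▸ this).congr' hev

end States

/-! ### Numerical range and the criterion for the norm distance -/

theorem norm_le_one_of_quadratic {H : Type v} [NormedAddCommGroup H] [InnerProductSpace ℂ H]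
    [CompleteSpace H] {T : H →L[ℂ] H} (hT : IsSelfAdjoint T)
    (h : ∀ x, |(⟪x, T x⟫_ℂ).re| ≤ ‖x‖ ^ 2) : ‖T‖ ≤ 1 := by
  refine T.opNorm_le_bound zero_le_one fun x ↦ ?_
  rw [one_mul]
  by_contra! hx
  have hTx : 0 < ‖T x‖ := (norm_nonneg _).trans_lt hx
  have hsymm : ∀ y z, ⟪y, T z⟫_ℂ = ⟪T y, z⟫_ℂ := fun y z ↦ by
    rw [← ContinuousLinearMap.adjoint_inner_left, ← ContinuousLinearMap.star_eq_adjoint,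
      hT.star_eq]
  -- Polarization: `T x` rescaled to the length of `x`, so that the forms at `x + y` and `x - y`
  -- together bound `4 ‖x‖ ‖T x‖` by `4 ‖x‖²`.
  set y : H := ((‖x‖ / ‖T x‖ : ℝ) : ℂ) • T x with hy
  have hyn : ‖y‖ = ‖x‖ := by
    rw [hy, norm_smul, Complex.norm_real, norm_div, norm_norm, norm_norm]
    field_simp
  have hin : (⟪y, T x⟫_ℂ).re = ‖x‖ * ‖T x‖ := by
    rw [hy, inner_smul_left, Complex.conj_ofReal, Complex.re_ofReal_mul,
      inner_self_eq_norm_sq_to_K]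
    rw [← RCLike.ofReal_pow]
    change _ * ‖T x‖ ^ 2 = _
    field_simp
  have hin' : (⟪x, T y⟫_ℂ).re = ‖x‖ * ‖T x‖ := by
    rw [hsymm, ← hin, ← inner_conj_symm, Complex.conj_re]
  have h1 := (abs_le.1 (h (x + y))).2
  have h2 := (abs_le.1 (h (x - y))).1
  have h3 := parallelogram_law_with_norm ℂ x y
  simp only [map_add, map_sub, inner_add_left, inner_add_right, inner_sub_left, inner_sub_right,
    Complex.add_re, Complex.sub_re] at h1 h2
  rw [hyn] at h3
  rcases (norm_nonneg x).eq_or_lt with h0 | h0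
  · rw [norm_eq_zero.1 h0.symm, map_zero, norm_zero] at hTx
    exact hTx.false
  · nlinarith [mul_lt_mul_of_pos_left hx h0]

theorem exists_norm_sub_smul_one_le {H : Type v} [NormedAddCommGroup H] [InnerProductSpace ℂ H]
    [CompleteSpace H] {T : H →L[ℂ] H} (hT : IsSelfAdjoint T)
    (h : ∀ ξ η : H, ‖η‖ ^ 2 * (⟪ξ, T ξ⟫_ℂ).re - ‖ξ‖ ^ 2 * (⟪η, T η⟫_ℂ).re ≤
      2 * ‖ξ‖ ^ 2 * ‖η‖ ^ 2) : ∃ c : ℝ, ‖T - (c : ℂ) • (1 : H →L[ℂ] H)‖ ≤ 1 := by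
  rcases subsingleton_or_nontrivial H with _ | _
  · exact ⟨0, by simp [Subsingleton.elim T 0]⟩
  set R : Set ℝ := {r | ∃ ξ : H, ξ ≠ 0 ∧ r = (⟪ξ, T ξ⟫_ℂ).re / ‖ξ‖ ^ 2}
  have hRR : ∀ r ∈ R, ∀ s ∈ R, r ≤ s + 2 := by
    rintro _ ⟨ξ, hξ, rfl⟩ _ ⟨η, hη, rfl⟩
    have h1 : 0 < ‖ξ‖ ^ 2 := by positivity
    have h2 : 0 < ‖η‖ ^ 2 := by positivity
    have h3 := h ξ η
    rw [div_add' _ _ _ h2.ne', div_le_div_iff₀ h1 h2]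
    linarith
  obtain ⟨ξ₀, hξ₀⟩ := exists_ne (0 : H)
  have hne : R.Nonempty := ⟨_, ξ₀, hξ₀, rfl⟩
  have hbdd : BddAbove R := ⟨_, fun r hr ↦ hRR r hr _ ⟨ξ₀, hξ₀, rfl⟩⟩
  -- With `M = sSup R` the numerical range lies in `[M - 2, M]`, whose midpoint is `M - 1`.
  refine ⟨sSup R - 1, norm_le_one_of_quadratic ?_ fun ξ ↦ ?_⟩
  · refine hT.sub (IsSelfAdjoint.smul ?_ (.one _))
    exact Complex.conj_ofReal _
  · rcases eq_or_ne ξ 0 with rfl | hξ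
    · simp
    have h1 : 0 < ‖ξ‖ ^ 2 := by positivity
    have hmem : (⟪ξ, T ξ⟫_ℂ).re / ‖ξ‖ ^ 2 ∈ R := ⟨ξ, hξ, rfl⟩
    have hu := le_csSup hbdd hmem
    have hl := csSup_le hne fun r hr ↦ hRR r hr _ hmem
    rw [div_le_iff₀ h1] at hu
    rw [div_add' _ _ _ h1.ne', le_div_iff₀ h1] at hl
    have : (⟪ξ, (T - ((sSup R - 1 : ℝ) : ℂ) • (1 : H →L[ℂ] H)) ξ⟫_ℂ).re =
        (⟪ξ, T ξ⟫_ℂ).re - (sSup R - 1) * ‖ξ‖ ^ 2 := by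
      rw [sub_apply, smul_apply, one_apply_eq_self, inner_sub_right, inner_smul_right,
        Complex.sub_re, Complex.re_ofReal_mul, inner_self_eq_norm_sq_to_K]
      norm_cast
    rw [this, abs_le]
    constructor <;> linarith

/-- If the commutator with `P` controls the oscillation of the quadratic forms of a faithful
representation `ρ`, then `P` induces the norm distance. -/
theorem inducesNormDistance_of_oscillation {A : Type u} [NonUnitalCStarAlgebra A]
    {H : Type v} [NormedAddCommGroup H] [InnerProductSpace ℂ H] [CompleteSpace H]
    {K : Type w} [NormedAddCommGroup K] [InnerProductSpace ℂ K] [CompleteSpace K]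
    (ρ : A →⋆ₙₐ[ℂ] (H →L[ℂ] H)) (hρ : Function.Injective ρ)
    (π : A →⋆ₙₐ[ℂ] (K →L[ℂ] K)) {P : K →L[ℂ] K} (hP : IsStarProjection P)
    (h : ∀ a, IsSelfAdjoint a → ‖P * π a - π a * P‖ ≤ 1 → ∀ ξ η : H,
      ‖η‖ ^ 2 * (⟪ξ, ρ a ξ⟫_ℂ).re - ‖ξ‖ ^ 2 * (⟪η, ρ a η⟫_ℂ).re ≤ 2 * ‖ξ‖ ^ 2 * ‖η‖ ^ 2) :
    InducesNormDistance π P := by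
  intro φ ψ hφ hψ
  constructor
  · rintro _ ⟨a, ha, hPa, rfl⟩
    let _ := CStarAlgebra.spectralOrder A
    have := CStarAlgebra.spectralOrderedRing A
    have hl := CStarAlgebra.increasingApproximateUnit A
    have := hl.neBot
    obtain ⟨c, hc⟩ := exists_norm_sub_smul_one_le (ha.map ρ) (h a ha hPa)
    -- `a - c` need not lie in `A`; its compression `x (a - c) x` by the approximate unit does, and
    -- has norm at most 1 because `ρ` is isometric.
    have hbound : ∀ᶠ x in CStarAlgebra.approximateUnit A,
        ‖(φ - ψ) (x * a * x - (c : ℂ) • (x * x))‖ ≤ ‖φ - ψ‖ := by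
      filter_upwards [hl.eventually_norm] with x hx
      refine (φ - ψ).unit_le_opNorm _ ?_
      rw [← NonUnitalStarAlgHom.norm_map ρ hρ]
      have : ρ (x * a * x - (c : ℂ) • (x * x)) =
          ρ x * (ρ a - (c : ℂ) • (1 : H →L[ℂ] H)) * ρ x := by
        simp only [map_sub, map_mul, map_smul, mul_sub, sub_mul, mul_smul_comm, smul_mul_assoc,
          mul_one]
      rw [this]
      have hρx : ‖ρ x‖ ≤ 1 := (NonUnitalStarAlgHom.norm_apply_le ρ x).trans hx
      refine (norm_mul_le _ _).trans (mul_le_one₀ ?_ (norm_nonneg _) hρx)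
      exact (norm_mul_le _ _).trans (mul_le_one₀ hρx (norm_nonneg _) hc)
    have ht1 : Filter.Tendsto (fun x ↦ x * a * x) (CStarAlgebra.approximateUnit A) (nhds a) := by
      have h0 : Filter.Tendsto (fun x ↦ (x * a - a) * x) (CStarAlgebra.approximateUnit A)
          (nhds 0) := by
        have h1 : Filter.Tendsto (fun x ↦ ‖x * a - a‖) (CStarAlgebra.approximateUnit A)
            (nhds 0) := by
          simpa using ((hl.tendsto_mul_right a).sub_const a).norm
        refine squeeze_zero_norm' ?_ h1
        filter_upwards [hl.eventually_norm] with x hx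
        exact (norm_mul_le _ _).trans (mul_le_of_le_one_right (norm_nonneg _) hx)
      have := h0.add (hl.tendsto_mul_left a)
      rw [zero_add] at this
      refine this.congr fun x ↦ ?_
      rw [sub_mul, sub_add_cancel]
    have ht2 := (((φ - ψ).continuous.tendsto a).comp ht1).sub
      ((hφ.tendsto_apply_mul_self.sub hψ.tendsto_apply_mul_self).const_mul (c : ℂ))
    simp only [sub_self, mul_zero, sub_zero] at ht2
    refine le_of_tendsto ht2.norm (hbound.mono fun x hx ↦ ?_)
    rw [map_sub, map_smul] at hx
    exact hx
  · intro b hb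
    have hb' : ∀ a : A, IsSelfAdjoint a → ‖a‖ ≤ 1 → ‖(φ - ψ) a‖ ≤ b := fun a ha ha1 ↦
      hb ⟨a, ha, (norm_commutator_le hP _).trans
        ((NonUnitalStarAlgHom.norm_apply_le π a).trans ha1), rfl⟩
    have hb0 : 0 ≤ b := by simpa using hb' 0 (.zero A) (by simp)
    refine opNorm_le_of_forall_norm_le_one (φ - ψ) hb0 fun a ha ↦ ?_
    -- Rotating `a` by a phase makes the value non-negative; since `φ - ψ` is real on self-adjoint
    -- elements, only the real part of `c • a` contributes.
    obtain ⟨c, hc, hca⟩ := Complex.exists_norm_eq_mul_self ((φ - ψ) a)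
    have him : ∀ x : A, IsSelfAdjoint x → ((φ - ψ) x).im = 0 := fun x hx ↦ by
      rw [sub_apply, Complex.sub_im, im_apply_eq_zero hφ.1 hx, im_apply_eq_zero hψ.1 hx, sub_zero]
    have hre : ((φ - ψ) (realPart (c • a) : A)).re = ‖(φ - ψ) a‖ := by
      have h1 : (φ - ψ) (c • a) = (‖(φ - ψ) a‖ : ℂ) := by rw [map_smul, smul_eq_mul, hca]
      rw [← realPart_add_I_smul_imaginaryPart (c • a), map_add, map_smul (φ - ψ)] at h1
      have h2 := congrArg Complex.re h1
      have h3 := him _ (imaginaryPart (c • a)).2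
      generalize (imaginaryPart (c • a) : A) = y at h2 h3
      generalize (realPart (c • a) : A) = x at h2 ⊢
      rwa [Complex.add_re, smul_eq_mul, Complex.I_mul_re, h3, neg_zero, add_zero,
        Complex.ofReal_re] at h2
    rw [← hre]
    refine (Complex.re_le_norm _).trans (hb' _ (realPart (c • a)).2 ?_)
    refine (realPart.norm_le (c • a)).trans ?_
    rw [norm_smul, hc, one_mul]
    exact ha

/-! ### From commutators to oscillation -/

theorem isStarProjection_half_one_add {B : Type*} [Ring B] [StarRing B] [Algebra ℂ B]
    [StarModule ℂ B] {s : B} (hs : s * s = 1) (hs' : IsSelfAdjoint s) :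
    IsStarProjection ((1 / 2 : ℂ) • (1 + s)) := by
  constructor
  · change ((1 / 2 : ℂ) • (1 + s)) * ((1 / 2 : ℂ) • (1 + s)) = (1 / 2 : ℂ) • (1 + s)
    rw [smul_mul_smul_comm, mul_add, add_mul, add_mul, hs]
    simp only [one_mul, mul_one]
    rw [show (1 + s + (s + 1) : B) = (2 : ℂ) • (1 + s) by rw [two_smul]; abel, smul_smul]
    norm_num
  · refine IsSelfAdjoint.smul ?_ ((IsSelfAdjoint.one B).add hs')
    simp [isSelfAdjoint_iff]

/-- As `P` fixes `x + y` and kills `x - y`, the pairing of `[P, X] (x - y)` with `x + y` is `⟪x + y,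
X (x - y)⟫`, and the cross terms cancel in its real part. -/
theorem re_inner_sub_le_of_commutator {H : Type*} [NormedAddCommGroup H] [InnerProductSpace ℂ H]
    [CompleteSpace H] {P X : H →L[ℂ] H} (hP : IsSelfAdjoint P) (hX : IsSelfAdjoint X)
    (hPX : ‖P * X - X * P‖ ≤ 1) {x y : H} (hadd : P (x + y) = x + y) (hsub : P (x - y) = 0) :
    (⟪x, X x⟫_ℂ).re - (⟪y, X y⟫_ℂ).re ≤ ‖x‖ ^ 2 + ‖y‖ ^ 2 := by
  have hPs : ∀ z, ⟪x + y, P z⟫_ℂ = ⟪x + y, z⟫_ℂ := fun z ↦ by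
    rw [← ContinuousLinearMap.adjoint_inner_left, ← ContinuousLinearMap.star_eq_adjoint,
      hP.star_eq, hadd]
  have hcross : (⟪y, X x⟫_ℂ).re = (⟪x, X y⟫_ℂ).re := by
    rw [← ContinuousLinearMap.adjoint_inner_left, ← ContinuousLinearMap.star_eq_adjoint,
      hX.star_eq, ← inner_conj_symm, Complex.conj_re]
  have key : (⟪x + y, (P * X - X * P) (x - y)⟫_ℂ).re = (⟪x, X x⟫_ℂ).re - (⟪y, X y⟫_ℂ).re := by
    rw [sub_apply, mul_apply_eq_comp, mul_apply_eq_comp, hsub, map_zero, sub_zero, hPs, map_sub]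
    simp only [inner_add_left, inner_sub_right, Complex.add_re, Complex.sub_re, hcross]
    ring
  have hle := (Complex.re_le_norm _).trans ((norm_inner_le_norm (x + y) _).trans
    (mul_le_mul_of_nonneg_left (ContinuousLinearMap.le_of_opNorm_le _ hPX (x - y))
      (norm_nonneg _)))
  rw [key] at hle
  -- `‖x + y‖ ‖x - y‖ ≤ ‖x‖² + ‖y‖²`, by AM–GM and the parallelogram law.
  nlinarith [parallelogram_law_with_norm ℂ x y, sq_nonneg (‖x + y‖ - ‖x - y‖)]

theorem re_inner_sub_le_of_half_one_add {H : Type*} [NormedAddCommGroup H]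
    [InnerProductSpace ℂ H] [CompleteSpace H] {S X : H →L[ℂ] H} (hS : S * S = 1)
    (hS' : IsSelfAdjoint S) (hX : IsSelfAdjoint X)
    (hSX : ‖((1 / 2 : ℂ) • (1 + S)) * X - X * ((1 / 2 : ℂ) • (1 + S))‖ ≤ 1) (x : H) :
    (⟪x, X x⟫_ℂ).re - (⟪S x, X (S x)⟫_ℂ).re ≤ ‖x‖ ^ 2 + ‖S x‖ ^ 2 := by
  have hSS : S (S x) = x := by rw [← mul_apply_eq_comp, hS, one_apply_eq_self]
  refine re_inner_sub_le_of_commutator (isStarProjection_half_one_add hS hS').isSelfAdjoint hX hSX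
    ?_ ?_
  · rw [smul_apply, add_apply, one_apply_eq_self, map_add, hSS, add_comm (S x), ← two_smul ℂ,
      smul_smul]
    norm_num
  · rw [smul_apply, add_apply, one_apply_eq_self, map_sub, hSS, sub_add_sub_cancel, sub_self,
      smul_zero]

theorem inner_self_eq_ofReal_norm_sq {H : Type*} [NormedAddCommGroup H] [InnerProductSpace ℂ H]
    (η : H) : ⟪η, η⟫_ℂ = ((‖η‖ ^ 2 : ℝ) : ℂ) := by
  rw [inner_self_eq_norm_sq_to_K]
  exact (Complex.ofReal_pow _ _).symm

theorem re_inner_self_mul {H : Type*} [NormedAddCommGroup H] [InnerProductSpace ℂ H]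
    (η : H) (z : ℂ) : (z * ⟪η, η⟫_ℂ).re = ‖η‖ ^ 2 * z.re := by
  rw [inner_self_eq_ofReal_norm_sq, mul_comm, Complex.re_ofReal_mul]

/-! ### Extending operators to the completion -/

section Completion

open UniformSpace

variable {E : Type*} [NormedAddCommGroup E] [InnerProductSpace ℂ E]

theorem completion_add (f g : E →L[ℂ] E) : (f + g).completion = f.completion + g.completion := by
  ext x
  induction x using Completion.induction_on with
  | hp => apply isClosed_eq <;> fun_prop
  | ih x => simp [Completion.coe_add]

theorem completion_smul (c : ℂ) (f : E →L[ℂ] E) : (c • f).completion = c • f.completion := by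
  ext x
  induction x using Completion.induction_on with
  | hp => exact isClosed_eq (c • f).completion.continuous (c • f.completion).continuous
  | ih x => simp

theorem completion_mul (f g : E →L[ℂ] E) : (f * g).completion = f.completion * g.completion := by
  ext x
  induction x using Completion.induction_on with
  | hp => apply isClosed_eq <;> fun_prop
  | ih x => simp

theorem completion_one : (1 : E →L[ℂ] E).completion = 1 := by
  ext x
  induction x using Completion.induction_on with
  | hp => apply isClosed_eq <;> fun_prop
  | ih x => simp

theorem completion_eq_star {f g : E →L[ℂ] E} (h : ∀ x y, ⟪f x, y⟫_ℂ = ⟪x, g y⟫_ℂ) :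
    f.completion = star g.completion := by
  refine (ContinuousLinearMap.eq_adjoint_iff _ _).2 fun x y ↦ ?_
  induction x, y using Completion.induction_on₂ with
  | hp => apply isClosed_eq <;> fun_prop
  | ih x y => simpa using h x y

end Completion

/-! ### The flip and the amplification -/

section Flip

variable {H : Type v} [NormedAddCommGroup H] [InnerProductSpace ℂ H]
variable {K : Type w} [NormedAddCommGroup K] [InnerProductSpace ℂ K]

variable (H) in
/-- The flip on `H ⊗ H`. -/
noncomputable def flip : HilbertTensor H H →L[ℂ] HilbertTensor H H :=
  ((TensorProduct.commIsometry ℂ H H).toContinuousLinearEquiv : H ⊗[ℂ] H →L[ℂ] H ⊗[ℂ] H).completion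

theorem flip_coe (x : H ⊗[ℂ] H) :
    flip H (x : HilbertTensor H H) = (TensorProduct.comm ℂ H H x : H ⊗[ℂ] H) :=
  ContinuousLinearMap.completion_apply_coe _ _

theorem flip_htmul (ξ η : H) : flip H (htmul ξ η) = htmul η ξ := flip_coe _

theorem flip_mul_flip : flip H * flip H = 1 := by
  rw [flip, ← completion_mul, ← completion_one]
  congr 1
  ext x
  simp

theorem isSelfAdjoint_flip [CompleteSpace H] : IsSelfAdjoint (flip H) := by
  refine (completion_eq_star fun x y ↦ ?_).symm
  change ⟪TensorProduct.comm ℂ H H x, y⟫_ℂ = ⟪x, TensorProduct.comm ℂ H H y⟫_ℂ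
  rw [← TensorProduct.inner_comm_comm x]
  simp

theorem inner_htmul (ξ ξ' : H) (η η' : K) :
    ⟪htmul ξ η, htmul ξ' η'⟫_ℂ = ⟪ξ, ξ'⟫_ℂ * ⟪η, η'⟫_ℂ := by
  rw [htmul, htmul, UniformSpace.Completion.inner_coe, TensorProduct.inner_tmul]

theorem norm_htmul (ξ : H) (η : K) : ‖htmul ξ η‖ = ‖ξ‖ * ‖η‖ := by
  rw [htmul, UniformSpace.Completion.norm_coe, TensorProduct.norm_tmul]

end Flip

section Tensor

variable {A : Type u} [NonUnitalCStarAlgebra A]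
variable {H : Type v} [NormedAddCommGroup H] [InnerProductSpace ℂ H] [CompleteSpace H]
variable {K : Type w} [NormedAddCommGroup K] [InnerProductSpace ℂ K]

theorem inner_rTensor_left (T : H →L[ℂ] H) (x y : H ⊗[ℂ] K) :
    ⟪(ContinuousLinearMap.adjoint T).rTensor K x, y⟫_ℂ = ⟪x, T.rTensor K y⟫_ℂ := by
  induction x using TensorProduct.induction_on with
  | zero => simp
  | add x₁ x₂ h₁ h₂ => rw [map_add, inner_add_left, inner_add_left, h₁, h₂]
  | tmul ξ η =>
    induction y using TensorProduct.induction_on with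
    | zero => simp
    | add y₁ y₂ h₁ h₂ => rw [map_add, inner_add_right, inner_add_right, h₁, h₂]
    | tmul ξ' η' =>
      rw [ContinuousLinearMap.rTensor_tmul, ContinuousLinearMap.rTensor_tmul,
        TensorProduct.inner_tmul, TensorProduct.inner_tmul,
        ContinuousLinearMap.adjoint_inner_left]

/-- The amplification `a ↦ ρ a ⊗ I` of a representation. -/
noncomputable def amplification (ρ : A →⋆ₙₐ[ℂ] (H →L[ℂ] H)) :
    A →⋆ₙₐ[ℂ] (HilbertTensor H K →L[ℂ] HilbertTensor H K) where
  toFun a := ((ρ a).rTensor K).completion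
  map_smul' c a := by
    rw [map_smul, ContinuousLinearMap.rTensor_smul, completion_smul]
    rfl
  map_zero' := by
    rw [map_zero, ContinuousLinearMap.rTensor_zero, ← zero_smul ℂ (0 : H ⊗[ℂ] K →L[ℂ] H ⊗[ℂ] K),
      completion_smul, zero_smul]
  map_add' a b := by
    rw [map_add, ContinuousLinearMap.rTensor_add, completion_add]
  map_mul' a b := by
    rw [map_mul, ContinuousLinearMap.rTensor_mul, completion_mul]
  map_star' a := by
    rw [map_star, ContinuousLinearMap.star_eq_adjoint]
    exact completion_eq_star (inner_rTensor_left (ρ a))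

theorem amplification_htmul (ρ : A →⋆ₙₐ[ℂ] (H →L[ℂ] H)) (a : A) (ξ : H) (η : K) :
    amplification ρ a (htmul ξ η) = htmul (ρ a ξ) η :=
  ContinuousLinearMap.completion_apply_coe _ _

theorem inducesNormDistance_flip (ρ : A →⋆ₙₐ[ℂ] (H →L[ℂ] H)) (hρ : Function.Injective ρ) :
    InducesNormDistance (amplification ρ) ((1 / 2 : ℂ) • (1 + flip H)) := by
  refine inducesNormDistance_of_oscillation ρ hρ _
    (isStarProjection_half_one_add flip_mul_flip isSelfAdjoint_flip) fun a hsa ha ξ η ↦ ?_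
  have h := re_inner_sub_le_of_half_one_add flip_mul_flip isSelfAdjoint_flip
    (hsa.map (amplification ρ)) ha (htmul ξ η)
  rw [flip_htmul, amplification_htmul, amplification_htmul, inner_htmul, inner_htmul, norm_htmul,
    norm_htmul, re_inner_self_mul, re_inner_self_mul] at h
  linarith

end Tensor

/-! ### The transposition on matrices -/

/-- The representation of `M_n` on `ℂⁿ`. -/
noncomputable def euclideanRep (n : ℕ) : CStarMatrix (Fin n) (Fin n) ℂ →⋆ₙₐ[ℂ]
    (EuclideanSpace ℂ (Fin n) →L[ℂ] EuclideanSpace ℂ (Fin n)) :=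
  ((CStarMatrix.ofMatrixStarAlgEquiv.symm.trans Matrix.toEuclideanCLM :
    CStarMatrix (Fin n) (Fin n) ℂ ≃⋆ₐ[ℂ] _) : _ →⋆ₙₐ[ℂ] _)

theorem euclideanRep_injective {n : ℕ} : Function.Injective (euclideanRep n) :=
  (CStarMatrix.ofMatrixStarAlgEquiv.symm.trans Matrix.toEuclideanCLM :
    CStarMatrix (Fin n) (Fin n) ℂ ≃⋆ₐ[ℂ] _).injective

theorem one_div_natCast_eq_ofReal (n : ℕ) : (1 / n : ℂ) = ((1 / n : ℝ) : ℂ) := by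
  push_cast
  rfl

section MatrixAlgebra

variable (n : ℕ) [NeZero n]

theorem transposition_mul_transposition : transposition n * transposition n = 1 := by
  ext x
  rw [mul_apply_eq_comp, transposition_apply, transposition_apply, LinearEquiv.symm_apply_apply,
    Matrix.transpose_transpose, LinearEquiv.apply_symm_apply, one_apply_eq_self]

theorem inner_transposition_left (x y : MatrixL2 n) :
    ⟪transposition n x, y⟫_ℂ = ⟪x, transposition n y⟫_ℂ := by
  rw [matrixL2_inner, matrixL2_inner, transposition_apply, transposition_apply,
    LinearEquiv.symm_apply_apply, LinearEquiv.symm_apply_apply, ← Matrix.trace_transpose,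
    Matrix.transpose_mul, Matrix.trace_mul_comm]
  rfl

theorem isSelfAdjoint_transposition : IsSelfAdjoint (transposition n) :=
  ((ContinuousLinearMap.eq_adjoint_iff _ _).2 (inner_transposition_left n)).symm

variable {n}

/-- The rank one matrix `ξ ηᵀ` as a vector of `L²(M_n, tr / n)`. -/
noncomputable def rankOneL2 (ξ η : EuclideanSpace ℂ (Fin n)) : MatrixL2 n :=
  toL2 n (Matrix.vecMulVec ξ η)

theorem transposition_rankOneL2 (ξ η : EuclideanSpace ℂ (Fin n)) :
    transposition n (rankOneL2 ξ η) = rankOneL2 η ξ := by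
  rw [transposition_apply, rankOneL2, LinearEquiv.symm_apply_apply, Matrix.transpose_vecMulVec]
  rfl

theorem inner_rankOneL2 (ξ η ξ' η' : EuclideanSpace ℂ (Fin n)) :
    ⟪rankOneL2 ξ η, rankOneL2 ξ' η'⟫_ℂ = (1 / (n : ℂ)) * (⟪ξ, ξ'⟫_ℂ * ⟪η, η'⟫_ℂ) := by
  rw [matrixL2_inner, rankOneL2, rankOneL2, LinearEquiv.symm_apply_apply,
    LinearEquiv.symm_apply_apply, Matrix.conjTranspose_vecMulVec, Matrix.vecMulVec_mul_vecMulVec,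
    Matrix.trace_vecMulVec, dotProduct_smul, EuclideanSpace.inner_eq_star_dotProduct,
    EuclideanSpace.inner_eq_star_dotProduct, dotProduct_comm (star ξ.ofLp),
    dotProduct_comm (star η.ofLp), smul_eq_mul]

theorem norm_sq_rankOneL2 (ξ η : EuclideanSpace ℂ (Fin n)) :
    ‖rankOneL2 ξ η‖ ^ 2 = 1 / n * (‖ξ‖ ^ 2 * ‖η‖ ^ 2) := by
  have h := inner_rankOneL2 ξ η ξ η
  rw [one_div_natCast_eq_ofReal] at h
  simp only [inner_self_eq_ofReal_norm_sq, ← Complex.ofReal_mul] at h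
  exact Complex.ofReal_injective h

theorem standardRep_rankOneL2 (a : CStarMatrix (Fin n) (Fin n) ℂ)
    (ξ η : EuclideanSpace ℂ (Fin n)) :
    standardRep n a (rankOneL2 ξ η) = rankOneL2 (euclideanRep n a ξ) η := by
  change toL2 n (CStarMatrix.ofMatrix.symm a * Matrix.vecMulVec ξ η) = _
  rw [Matrix.mul_vecMulVec]
  rfl

-- The criterion is applied with the faithful representation on `ℂⁿ`: the rank one matrix `ξ ηᵀ`
-- plays the role of `ξ ⊗ η`, and left multiplication acts on `ξ` only.
variable (n) in
theorem inducesNormDistance_transposition :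
    InducesNormDistance (standardRep n) ((1 / 2 : ℂ) • (1 + transposition n)) := by
  refine inducesNormDistance_of_oscillation (euclideanRep n) euclideanRep_injective _
    (isStarProjection_half_one_add (transposition_mul_transposition n)
      (isSelfAdjoint_transposition n)) fun a hsa ha ξ η ↦ ?_
  have h := re_inner_sub_le_of_half_one_add (transposition_mul_transposition n)
    (isSelfAdjoint_transposition n) (hsa.map (standardRep n)) ha (rankOneL2 ξ η)
  have hn : (0 : ℝ) < 1 / n := by
    have := NeZero.pos n
    positivity
  have hre : ∀ z : ℂ, (1 / (n : ℂ) * z).re = 1 / n * z.re := fun z ↦ by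
    rw [one_div_natCast_eq_ofReal, Complex.re_ofReal_mul]
  rw [transposition_rankOneL2, standardRep_rankOneL2, standardRep_rankOneL2, inner_rankOneL2,
    inner_rankOneL2, norm_sq_rankOneL2, norm_sq_rankOneL2, hre, hre, re_inner_self_mul,
    re_inner_self_mul] at h
  refine le_of_mul_le_mul_left ?_ hn
  linarith

end MatrixAlgebra

/-! ### Shift systems from infinite projections -/

section ShiftSystem

/-- A sequence of partial isometries with common initial projection `u 0` and mutually orthogonal
ranges. -/
structure IsShiftSystem {B : Type*} [Ring B] [StarRing B] (u : ℕ → B) : Prop where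
  star_mul_self : ∀ n, star (u n) * u n = u 0
  star_mul_of_ne : ∀ {m n}, m ≠ n → star (u m) * u n = 0
  mul_zero_eq : ∀ n, u n * u 0 = u n


/-- Wold-type argument: `v` is an isometry on the range of `z`, and its powers move the wandering
part `z - q` to mutually orthogonal pieces. -/
theorem isShiftSystem_of_infinite {B : Type*} [CStarAlgebra B] {v z q : B}
    (hz : IsStarProjection z) (hq : IsStarProjection q) (hzq : z * q = q) (hzv : z * v = v * z)
    (hv : star v * v = z) (hv' : v * star v = q) : IsShiftSystem fun n ↦ v ^ n * (z - q) := by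
  have hzs : star z = z := hz.isSelfAdjoint.star_eq
  have hqs : star q = q := hq.isSelfAdjoint.star_eq
  have hzz : z * z = z := hz.isIdempotentElem.eq
  have hqq : q * q = q := hq.isIdempotentElem.eq
  have hqz : q * z = q := by rw [← hqs, ← hzs, ← star_mul, hzq]
  have hvz : v * z = v := by
    rw [← sub_eq_zero, ← CStarRing.star_mul_self_eq_zero_iff]
    simp only [star_sub, star_mul, hzs, sub_mul, mul_sub, mul_assoc]
    simp only [← mul_assoc (star v) v, hv, hzz, sub_self]
  have hqv : q * v = v := by rw [← hv', mul_assoc, hv, hvz]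
  set p := z - q with hp
  have hps : star p = p := by rw [hp, star_sub, hzs, hqs]
  have hpp : p * p = p := by
    rw [hp, sub_mul, mul_sub, mul_sub, hzz, hzq, hqz, hqq, sub_self, sub_zero]
  -- The source of all orthogonality: the range of `v` lies under `q`, hence is orthogonal to `p`.
  have hpv : p * v = 0 := by rw [hp, sub_mul, hzv, hvz, hqv, sub_self]
  have hzp : z * p = p := by rw [hp, mul_sub, hzz, hzq]
  have hshift : ∀ n, star v * (v ^ (n + 1) * p) = v ^ n * p := fun n ↦ by
    have hc : z * v ^ n = v ^ n * z := (show Commute z v from hzv).pow_right n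
    rw [pow_succ', mul_assoc, ← mul_assoc (star v), hv, ← mul_assoc, hc, mul_assoc, hzp]
  have hstar : ∀ m k, star (v ^ m * p) * (v ^ (m + k) * p) = p * (v ^ k * p) := by
    intro m k
    induction m with
    | zero => rw [pow_zero, one_mul, hps, zero_add]
    | succ m ih =>
      rw [← ih, add_right_comm, pow_succ', mul_assoc v, star_mul, mul_assoc, hshift]
  have hlt : ∀ m k, star (v ^ m * p) * (v ^ (m + (k + 1)) * p) = 0 := fun m k ↦ by
    rw [hstar, pow_succ', mul_assoc, ← mul_assoc, hpv, zero_mul]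
  refine ⟨fun n ↦ ?_, fun {m n} hmn ↦ ?_, fun n ↦ ?_⟩
  · simpa [hpp] using hstar n 0
  · rcases hmn.lt_or_gt with h | h
    · obtain ⟨k, rfl⟩ := Nat.exists_eq_add_of_lt h
      exact hlt m k
    · obtain ⟨k, rfl⟩ := Nat.exists_eq_add_of_lt h
      rw [← star_star (v ^ n * p), ← star_mul]
      exact (congrArg star (hlt n k)).trans (star_zero _)
  · rw [pow_zero, one_mul, mul_assoc, hpp]

theorem abs_mul_eq_zero {B : Type*} [CStarAlgebra B] [PartialOrder B] [StarOrderedRing B]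
    {t w : B} (h : t * w = 0) : CFC.abs t * w = 0 := by
  have hs : star (CFC.abs t) = CFC.abs t := (CFC.abs_nonneg t).isSelfAdjoint.star_eq
  rw [← CStarRing.star_mul_self_eq_zero_iff, star_mul, hs, mul_assoc, ← mul_assoc (CFC.abs t),
    CFC.abs_mul_abs, mul_assoc, h, mul_zero, mul_zero]

theorem abs_mul_abs_eq_zero {B : Type*} [CStarAlgebra B] [PartialOrder B] [StarOrderedRing B]
    {s t : B} (h : s * star t = 0) : CFC.abs s * CFC.abs t = 0 := by
  have hs : star (CFC.abs s) = CFC.abs s := (CFC.abs_nonneg s).isSelfAdjoint.star_eq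
  have ht : star (CFC.abs t) = CFC.abs t := (CFC.abs_nonneg t).isSelfAdjoint.star_eq
  have h1 : t * CFC.abs s = 0 := by
    rw [← star_star t, ← hs, ← star_mul, abs_mul_eq_zero h, star_zero]
  rw [← hs, ← ht, ← star_mul, abs_mul_eq_zero h1, star_zero]

end ShiftSystem

/-! ### Exhausting the space by shift systems -/

section Commutant

variable {H : Type v} [NormedAddCommGroup H] [InnerProductSpace ℂ H] [CompleteSpace H]

theorem commute_starProjection (K : Submodule ℂ H) [K.HasOrthogonalProjection] {x : H →L[ℂ] H}
    (hx : ∀ k ∈ K, x k ∈ K) (hx' : ∀ k ∈ K, star x k ∈ K) : Commute K.starProjection x := by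
  have h1 : ∀ y : H →L[ℂ] H, (∀ k ∈ K, y k ∈ K) →
      K.starProjection * (y * K.starProjection) = y * K.starProjection := fun y hy ↦ by
    ext ξ
    exact Submodule.starProjection_eq_self_iff.2 (hy _ (K.starProjection_apply_mem ξ))
  have hs : star K.starProjection = K.starProjection :=
    (isStarProjection_starProjection (U := K)).isSelfAdjoint.star_eq
  have h2 := congrArg star (h1 _ hx')
  rw [star_mul, star_mul, star_star, hs, mul_assoc, h1 x hx] at h2
  exact h2.symm

/-- The vectors `y (u 0 ξ)` with `y` in `N` and `u` in `S`. -/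
def generatedVectors (N : VonNeumannAlgebra H) (S : Set (ℕ → H →L[ℂ] H)) : Set H :=
  {x | ∃ y ∈ N, ∃ u ∈ S, ∃ ξ : H, y (u 0 ξ) = x}

/-- A set of shift systems in `N` with mutually orthogonal ranges. -/
structure IsOrthogonalShiftFamily (N : VonNeumannAlgebra H) (S : Set (ℕ → H →L[ℂ] H)) :
    Prop where
  mem : ∀ u ∈ S, ∀ n, u n ∈ N
  isShiftSystem : ∀ u ∈ S, IsShiftSystem u
  star_mul_eq_zero : ∀ u ∈ S, ∀ u' ∈ S, u ≠ u' → ∀ m n, star (u m) * u' n = 0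

theorem IsOrthogonalShiftFamily.star_mul_of_ne {N : VonNeumannAlgebra H}
    {S : Set (ℕ → H →L[ℂ] H)} (hS : IsOrthogonalShiftFamily N S) {u u' : ℕ → H →L[ℂ] H}
    (hu : u ∈ S) (hu' : u' ∈ S) {m n : ℕ} (hmn : m ≠ n) : star (u m) * u' n = 0 := by
  by_cases h : u = u'
  · subst h
    exact (hS.isShiftSystem u hu).star_mul_of_ne hmn
  · exact hS.star_mul_eq_zero u hu u' hu' h m n

theorem exists_maximal_isOrthogonalShiftFamily (N : VonNeumannAlgebra H) :
    ∃ S, Maximal (IsOrthogonalShiftFamily N) S := by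
  refine zorn_subset {S | IsOrthogonalShiftFamily N S} fun c hc hchain ↦
    ⟨⋃₀ c, ⟨?_, ?_, ?_⟩, fun s hs ↦ Set.subset_sUnion_of_mem hs⟩
  · rintro u ⟨s, hs, hus⟩
    exact (hc hs).mem u hus
  · rintro u ⟨s, hs, hus⟩
    exact (hc hs).isShiftSystem u hus
  · rintro u ⟨s, hs, hus⟩ u' ⟨s', hs', hus'⟩ hne
    rcases hchain.total hs hs' with h | h
    · exact (hc hs').star_mul_eq_zero u (h hus) u' hus' hne
    · exact (hc hs).star_mul_eq_zero u hus u' (h hus') hne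

/-- Take a maximal orthogonal family. The projection `e` onto the closed span is central, since the
span is invariant under both `ρ(A)` and its commutant; were `1 - e` non-zero, it would be infinite
and supply one more orthogonal system. -/
theorem exists_dense_isOrthogonalShiftFamily {A : Type u} [NonUnitalCStarAlgebra A]
    (ρ : A →⋆ₙₐ[ℂ] (H →L[ℂ] H)) (hinf : IsProperlyInfinite (repCommutant ρ)) :
    ∃ S, IsOrthogonalShiftFamily (repCommutant ρ) S ∧
      Dense (Submodule.span ℂ (generatedVectors (repCommutant ρ) S) : Set H) := by
  set N := repCommutant ρ with hN
  obtain ⟨S, hS⟩ := exists_maximal_isOrthogonalShiftFamily N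
  refine ⟨S, hS.prop, ?_⟩
  rw [Submodule.dense_iff_topologicalClosure_eq_top]
  set K := (Submodule.span ℂ (generatedVectors N S)).topologicalClosure with hK
  have hinv : ∀ x : H →L[ℂ] H, (∀ g ∈ generatedVectors N S, x g ∈ generatedVectors N S) →
      ∀ k ∈ K, x k ∈ K := by
    intro x hx k hk
    have h1 : Submodule.span ℂ (generatedVectors N S) ≤ K.comap x.toLinearMap :=
      Submodule.span_le.2 fun g hg ↦
        Submodule.le_topologicalClosure _ (Submodule.subset_span (hx g hg))
    have hcl : IsClosed ((K.comap x.toLinearMap : Submodule ℂ H) : Set H) :=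
      (Submodule.isClosed_topologicalClosure _).preimage x.continuous
    exact Submodule.topologicalClosure_minimal _ h1 hcl hk
  have : CompleteSpace K := (Submodule.isClosed_topologicalClosure _).completeSpace_coe
  set e := K.starProjection with he
  have heproj : IsStarProjection e := isStarProjection_starProjection
  have heN : e ∈ N := by
    rw [mem_repCommutant_iff]
    have hρ : ∀ a, ∀ k ∈ K, ρ a k ∈ K := fun a ↦ hinv _ <| by
      rintro _ ⟨y, hy, u, hu, ξ, rfl⟩
      refine ⟨y, hy, u, hu, ρ a ξ, ?_⟩
      have h1 := (mem_repCommutant_iff ρ _).1 (hS.prop.mem u hu 0) a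
      have h2 := (mem_repCommutant_iff ρ _).1 hy a
      rw [← mul_apply_eq_comp (u 0), ← h1, mul_apply_eq_comp, ← mul_apply_eq_comp y, ← h2,
        mul_apply_eq_comp]
    intro a
    refine (commute_starProjection K (hρ a) ?_).symm
    rw [← map_star]
    exact hρ _
  have hec : ∀ x ∈ N, e * x = x * e := by
    have hx : ∀ x ∈ N, ∀ k ∈ K, x k ∈ K := fun x hx ↦ hinv _ <| by
      rintro _ ⟨y, hy, u, hu, ξ, rfl⟩
      exact ⟨x * y, mul_mem hx hy, u, hu, ξ, rfl⟩
    exact fun x hxN ↦ commute_starProjection K (hx x hxN) (hx _ (star_mem hxN))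
  have heu : ∀ u ∈ S, ∀ n, e * u n = u n := by
    intro u hu n
    ext ξ
    refine Submodule.starProjection_eq_self_iff.2
      (Submodule.le_topologicalClosure _ (Submodule.subset_span ?_))
    refine ⟨u n, hS.prop.mem u hu n, u, hu, ξ, ?_⟩
    rw [← mul_apply_eq_comp, (hS.prop.isShiftSystem u hu).mul_zero_eq]
    rfl
  by_contra hne
  have hz0 : 1 - e ≠ 0 := by
    intro h0
    apply hne
    rw [eq_top_iff]
    intro x _
    rw [← Submodule.starProjection_eq_self_iff, ← he, ← sub_eq_zero.1 h0, one_apply_eq_self]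
  obtain ⟨q, hqN, hq, hzq, hqz, v, hvN, hv, hv'⟩ := hinf (1 - e) (sub_mem (one_mem _) heN)
    heproj.one_sub (fun x hx ↦ by rw [sub_mul, mul_sub, one_mul, mul_one, hec x hx]) hz0
  have hsys : IsShiftSystem fun n ↦ v ^ n * ((1 - e) - q) :=
    isShiftSystem_of_infinite heproj.one_sub hq hzq
      (by rw [sub_mul, mul_sub, one_mul, mul_one, hec v hvN]) hv hv'
  set w : ℕ → H →L[ℂ] H := fun n ↦ v ^ n * ((1 - e) - q) with hw
  have hp : (1 - e) * ((1 - e) - q) = (1 - e) - q := by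
    rw [mul_sub, hzq, heproj.one_sub.isIdempotentElem.eq]
  have hwN : ∀ n, w n ∈ N := fun n ↦
    mul_mem (pow_mem hvN n) (sub_mem (sub_mem (one_mem _) heN) hqN)
  have hew : ∀ n, e * w n = 0 := fun n ↦ by
    have hee : e * (1 - e) = 0 := by rw [mul_sub, mul_one, heproj.isIdempotentElem.eq, sub_self]
    have hep : e * ((1 - e) - q) = 0 := by rw [← hp, ← mul_assoc e, hee, zero_mul]
    change e * (v ^ n * ((1 - e) - q)) = 0
    rw [← mul_assoc, hec _ (pow_mem hvN n), mul_assoc, hep, mul_zero]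
  have hes : star e = e := heproj.isSelfAdjoint.star_eq
  have hort : ∀ u ∈ S, ∀ m n, star (u m) * w n = 0 := fun u hu m n ↦ by
    rw [← heu u hu, star_mul, hes, mul_assoc, hew, mul_zero]
  have hins : IsOrthogonalShiftFamily N (insert w S) := by
    refine ⟨?_, ?_, ?_⟩
    · rintro u (rfl | hu)
      exacts [hwN, hS.prop.mem u hu]
    · rintro u (rfl | hu)
      exacts [hsys, hS.prop.isShiftSystem u hu]
    · rintro u (rfl | hu) u' (rfl | hu') hne m n
      · exact (hne rfl).elim
      · rw [← star_star (u' n), ← star_mul, hort u' hu', star_zero]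
      · exact hort u hu m n
      · exact hS.prop.star_mul_eq_zero u hu u' hu' hne m n
  have hwS : w ∈ S := hS.le_of_ge hins (Set.subset_insert _ _) (Set.mem_insert _ _)
  -- The new system lies under `1 - e`, yet by maximality also under `e`, so its initial projection
  -- `(1 - e) - q` vanishes, against `q ≠ 1 - e`.
  have h0 := (heu w hwS 0).symm.trans (hew 0)
  rw [hw] at h0
  simp only [pow_zero, one_mul] at h0
  exact hqz (sub_eq_zero.1 h0).symm

end Commutant

/-! ### Orthogonal replacement vectors and the projection -/

section Disjoint

variable {H : Type v} [NormedAddCommGroup H] [InnerProductSpace ℂ H] [CompleteSpace H]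

/-- A sum of terms `y (u 0 ζ)` is rewritten with its `i`-th term passing through the range of `u (r
i)`. Injectivity of `r` keeps these ranges orthogonal even when the same `u` recurs, so a single `T`
recovers every term. -/
theorem IsOrthogonalShiftFamily.exists_apply_eq {N : VonNeumannAlgebra H}
    {S : Set (ℕ → H →L[ℂ] H)} (hS : IsOrthogonalShiftFamily N S) {r : ℕ → ℕ}
    (hr : Function.Injective r) {ξ : H} (hξ : ξ ∈ Submodule.span ℂ (generatedVectors N S)) :
    ∃ T ∈ N, ∃ ζ : H, T ζ = ξ ∧
      ∀ w : H →L[ℂ] H, (∀ u ∈ S, ∀ j, star (u (r j)) * w = 0) → T * w = 0 := by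
  obtain ⟨n, c, g, rfl⟩ := Submodule.mem_span_set'.1 hξ
  choose y hy u hu ζ hζ using fun i ↦ (g i).2
  refine ⟨∑ i, c i • (y i * star (u i (r i))), ?_, ∑ i, u i (r i) (ζ i), ?_, ?_⟩
  · refine sum_mem fun i _ ↦ N.toStarSubalgebra.smul_mem ?_ _
    exact mul_mem (hy i) (star_mem (hS.mem _ (hu i) _))
  · rw [sum_apply]
    refine Finset.sum_congr rfl fun i _ ↦ ?_
    rw [smul_apply, mul_apply_eq_comp, map_sum, Finset.sum_eq_single i]
    · rw [← mul_apply_eq_comp (star _), (hS.isShiftSystem _ (hu i)).star_mul_self, hζ]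
    · intro j _ hji
      rw [← mul_apply_eq_comp (star _), hS.star_mul_of_ne (hu i) (hu j), zero_apply]
      exact fun h ↦ hji (Fin.ext (hr h)).symm
    · exact fun h ↦ (h (Finset.mem_univ i)).elim
  · intro w hw
    rw [Finset.sum_mul]
    refine Finset.sum_eq_zero fun i _ ↦ ?_
    rw [smul_mul_assoc, mul_assoc, hw _ (hu i), mul_zero, smul_zero]

/-- Countably many vectors of the span can be replaced by vectors with the same functionals on
the commutant of `N` and mutually orthogonal cyclic subspaces. -/
theorem IsOrthogonalShiftFamily.exists_disjoint {N : VonNeumannAlgebra H}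
    {S : Set (ℕ → H →L[ℂ] H)} (hS : IsOrthogonalShiftFamily N S) {ι : Type*} [Countable ι]
    (ξ : ι → H) (hξ : ∀ i, ξ i ∈ Submodule.span ℂ (generatedVectors N S)) :
    ∃ ξ' : ι → H, ∀ X : H →L[ℂ] H, (∀ y ∈ N, y * X = X * y) →
      (∀ i, ⟪ξ' i, X (ξ' i)⟫_ℂ = ⟪ξ i, X (ξ i)⟫_ℂ) ∧
      ∀ i j, i ≠ j → ⟪ξ' i, X (ξ' j)⟫_ℂ = 0 := by
  obtain ⟨f, hf⟩ := Countable.exists_injective_nat ι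
  -- The pairing function splits the indices into disjoint infinite rows, one per vector, which
  -- makes `T i * star (T j) = 0` for `i ≠ j`.
  have hrow : ∀ i, Function.Injective fun j ↦ Nat.pair (f i) j := fun i j k h ↦
    (Nat.pair_eq_pair.1 h).2
  choose T hTN ζ hTζ hT using fun i ↦ hS.exists_apply_eq (hrow i) (hξ i)
  have hTT : ∀ i j, i ≠ j → T i * star (T j) = 0 := fun i j hij ↦ hT i _ fun u hu k ↦ by
    rw [← star_mul, hT j (u (Nat.pair (f i) k)), star_zero]
    exact fun u' hu' k' ↦ hS.star_mul_of_ne hu' hu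
      fun h ↦ hij (hf (Nat.pair_eq_pair.1 h).1).symm
  have hin : ∀ (Y : H →L[ℂ] H) (x y : H), ⟪Y x, y⟫_ℂ = ⟪x, (star Y) y⟫_ℂ := fun Y x y ↦ by
    rw [ContinuousLinearMap.star_eq_adjoint, ContinuousLinearMap.adjoint_inner_right]
  have habs : ∀ i, star (CFC.abs (T i)) = CFC.abs (T i) := fun i ↦
    (CFC.abs_nonneg (T i)).isSelfAdjoint.star_eq
  -- For `X` commuting with `N`, `⟪|T| ζ, X |T| ζ⟫ = ⟪ζ, X T⋆T ζ⟫ = ⟪T ζ, X T ζ⟫`, so `|T| ζ` has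
  -- the functional of `T ζ = ξ`, while `|T i| |T j| = 0` gives disjointness.
  refine ⟨fun i ↦ CFC.abs (T i) (ζ i), fun X hX ↦ ?_⟩
  have hcomm : ∀ i, CFC.abs (T i) * X = X * CFC.abs (T i) := fun i ↦ by
    refine Commute.cfcAbs_left (hX _ (hTN i)) ?_
    have := congrArg star (hX _ (star_mem (hTN i)))
    rw [star_mul, star_mul, star_star] at this
    exact this.symm
  refine ⟨fun i ↦ ?_, fun i j hij ↦ ?_⟩
  · simp only
    rw [hin, habs, ← mul_apply_eq_comp X, ← mul_apply_eq_comp, ← mul_assoc, hcomm, mul_assoc,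
      CFC.abs_mul_abs, ← mul_assoc, ← hX _ (star_mem (hTN i)), mul_assoc, ← hX _ (hTN i),
      ← hTζ i]
    rw [hin, mul_apply_eq_comp, ← mul_apply_eq_comp X, hX _ (hTN i)]
  · simp only
    rw [hin, habs, ← mul_apply_eq_comp X, ← mul_apply_eq_comp, ← mul_assoc, hcomm, mul_assoc,
      abs_mul_abs_eq_zero (hTT i j hij), mul_zero, zero_apply, inner_zero_right]

theorem exists_inducesNormDistance_of_properlyInfinite {A : Type u} [NonUnitalCStarAlgebra A]
    [TopologicalSpace.SeparableSpace H] (ρ : A →⋆ₙₐ[ℂ] (H →L[ℂ] H)) (hρ : Function.Injective ρ)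
    (hinf : IsProperlyInfinite (repCommutant ρ)) :
    ∃ P : H →L[ℂ] H, IsStarProjection P ∧ InducesNormDistance ρ P := by
  obtain ⟨S, hS, hdense⟩ := exists_dense_isOrthogonalShiftFamily ρ hinf
  have := UniformSpace.secondCountable_of_separable H
  set D := Submodule.span ℂ (generatedVectors (repCommutant ρ) S)
  obtain ⟨t, htD, htc, ht⟩ := hdense.exists_countable_dense_subset
  have := htc.to_subtype
  obtain ⟨ξ', hξ'⟩ := hS.exists_disjoint (ι := (t × t) × Bool)
    -- Each pair `(ξ, η)` is scaled to `‖η‖ ξ` and `‖ξ‖ η`, of equal norm; this is what makes the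
    -- sum and the difference of the replaced vectors orthogonal.
    (fun i ↦ cond i.2 ((‖(i.1.2 : H)‖ : ℂ) • (i.1.1 : H)) ((‖(i.1.1 : H)‖ : ℂ) • (i.1.2 : H)))
    (fun ⟨⟨x, y⟩, b⟩ ↦ by
      cases b
      exacts [D.smul_mem _ (htD y.2), D.smul_mem _ (htD x.2)])
  -- The case `X = 1`: norms are preserved and the replaced vectors are mutually orthogonal.
  have hone := hξ' 1 fun y _ ↦ by rw [one_mul, mul_one]
  simp only [one_apply_eq_self] at hone
  obtain ⟨hself, hort⟩ := hone
  have hnorm : ∀ (p : t × t) (b : Bool), ‖ξ' (p, b)‖ ^ 2 = ‖(p.1 : H)‖ ^ 2 * ‖(p.2 : H)‖ ^ 2 := by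
    intro p b
    have h := hself (p, b)
    rw [inner_self_eq_ofReal_norm_sq, inner_self_eq_ofReal_norm_sq] at h
    rw [Complex.ofReal_injective h]
    cases b <;> simp [norm_smul, mul_pow, mul_comm]
  set K := (Submodule.span ℂ (Set.range fun p : t × t ↦ ξ' (p, true) + ξ' (p, false))
    ).topologicalClosure with hK
  have : CompleteSpace K := (Submodule.isClosed_topologicalClosure _).completeSpace_coe
  have hP : IsStarProjection K.starProjection := isStarProjection_starProjection
  have hadd : ∀ p : t × t, K.starProjection (ξ' (p, true) + ξ' (p, false)) =
      ξ' (p, true) + ξ' (p, false) := fun p ↦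
    Submodule.starProjection_eq_self_iff.2
      (Submodule.le_topologicalClosure _ (Submodule.subset_span ⟨p, rfl⟩))
  have hsub : ∀ p : t × t, K.starProjection (ξ' (p, true) - ξ' (p, false)) = 0 := by
    intro p
    rw [Submodule.starProjection_apply_eq_zero_iff, hK, Submodule.orthogonal_closure,
      Submodule.mem_orthogonal]
    refine fun u hu ↦ Submodule.mem_orthogonal_singleton_iff_inner_left.1
      (Submodule.span_le (p := (ℂ ∙ (ξ' (p, true) - ξ' (p, false)))ᗮ).2 ?_ hu)
    rintro _ ⟨q, rfl⟩
    refine Submodule.mem_orthogonal_singleton_iff_inner_left.2 ?_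
    rw [inner_add_left, inner_sub_right, inner_sub_right]
    rcases eq_or_ne q p with rfl | hqp
    · rw [hort (q, true) (q, false) (by simp), hort (q, false) (q, true) (by simp), inner_self_eq_ofReal_norm_sq,
        inner_self_eq_ofReal_norm_sq, hnorm, hnorm]
      ring
    · rw [hort _ _ (by simp [hqp]), hort _ _ (by simp [hqp]), hort _ _ (by simp [hqp]),
        hort _ _ (by simp [hqp])]
      ring
  refine ⟨K.starProjection, hP, inducesNormDistance_of_oscillation ρ hρ ρ hP
    fun a ha hPa ξ η ↦ ?_⟩
  -- The case `X = ρ a`: the quadratic form of `ρ a` is unchanged by the replacement.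
  have hX := (hξ' (ρ a) fun y hy ↦ ((mem_repCommutant_iff ρ y).1 hy a).symm).1
  have hclosed : IsClosed {p : H × H | ‖p.2‖ ^ 2 * (⟪p.1, ρ a p.1⟫_ℂ).re -
      ‖p.1‖ ^ 2 * (⟪p.2, ρ a p.2⟫_ℂ).re ≤ 2 * ‖p.1‖ ^ 2 * ‖p.2‖ ^ 2} := by
    refine isClosed_le ?_ (by fun_prop)
    have h1 : Continuous fun p : H × H ↦ (⟪p.1, ρ a p.1⟫_ℂ).re :=
      Complex.continuous_re.comp (by fun_prop)
    have h2 : Continuous fun p : H × H ↦ (⟪p.2, ρ a p.2⟫_ℂ).re :=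
      Complex.continuous_re.comp (by fun_prop)
    fun_prop
  have hsubset : t ×ˢ t ⊆ {p : H × H | ‖p.2‖ ^ 2 * (⟪p.1, ρ a p.1⟫_ℂ).re -
      ‖p.1‖ ^ 2 * (⟪p.2, ρ a p.2⟫_ℂ).re ≤ 2 * ‖p.1‖ ^ 2 * ‖p.2‖ ^ 2} := by
    rintro ⟨x, y⟩ ⟨hx, hy⟩
    have h := re_inner_sub_le_of_commutator hP.isSelfAdjoint (ha.map ρ) hPa
      (hadd (⟨x, hx⟩, ⟨y, hy⟩)) (hsub (⟨x, hx⟩, ⟨y, hy⟩))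
    have hsmul : ∀ (c : ℝ) (z : H), (⟪(c : ℂ) • z, ρ a ((c : ℂ) • z)⟫_ℂ).re =
        c ^ 2 * (⟪z, ρ a z⟫_ℂ).re := fun c z ↦ by
      rw [map_smul, inner_smul_left, inner_smul_right, Complex.conj_ofReal, Complex.re_ofReal_mul,
        Complex.re_ofReal_mul]
      ring
    rw [hX, hX, hnorm, hnorm] at h
    simp only [cond_true, cond_false, hsmul] at h
    rw [Set.mem_ofPred_eq]
    linarith
  -- The inequality is a closed condition on `(ξ, η)`, so the dense set of pairs suffices.
  exact hclosed.closure_subset_iff.2 hsubset ((ht.prod ht) (ξ, η))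

end Disjoint

end UniformMetric

theorem theorem5p3 :
    (∀ (A : Type u) [NonUnitalCStarAlgebra A]
        (H : Type v) [NormedAddCommGroup H] [InnerProductSpace ℂ H] [CompleteSpace H]
        (ρ : A →⋆ₙₐ[ℂ] (H →L[ℂ] H)),
        Function.Injective ρ → UniformMetric.IsNondegenerate ρ →
        (∃ (π : A →⋆ₙₐ[ℂ] (UniformMetric.HilbertTensor H H →L[ℂ] UniformMetric.HilbertTensor H H))
            (S P : UniformMetric.HilbertTensor H H →L[ℂ] UniformMetric.HilbertTensor H H),
            UniformMetric.IsAmplification ρ π ∧ UniformMetric.IsFlip S ∧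
            P = (1 / 2 : ℂ) • (1 + S) ∧ IsStarProjection P ∧
            UniformMetric.InducesNormDistance π P) ∧
        (TopologicalSpace.SeparableSpace H →
          UniformMetric.IsProperlyInfinite (UniformMetric.repCommutant ρ) →
          ∃ P : H →L[ℂ] H, IsStarProjection P ∧ UniformMetric.InducesNormDistance ρ P)) ∧
    (∀ (n : ℕ) [NeZero n],
        IsStarProjection ((1 / 2 : ℂ) • (1 + UniformMetric.transposition n)) ∧
        UniformMetric.InducesNormDistance (A := CStarMatrix (Fin n) (Fin n) ℂ)
          (UniformMetric.standardRep n)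
          ((1 / 2 : ℂ) • (1 + UniformMetric.transposition n))) := by
  refine ⟨fun A _ H _ _ _ ρ hρ _ ↦ ⟨⟨UniformMetric.amplification ρ, UniformMetric.flip H, _,
    UniformMetric.amplification_htmul ρ, UniformMetric.flip_htmul, rfl,
    UniformMetric.isStarProjection_half_one_add UniformMetric.flip_mul_flip
      UniformMetric.isSelfAdjoint_flip, UniformMetric.inducesNormDistance_flip ρ hρ⟩,
    fun _ hinf ↦ UniformMetric.exists_inducesNormDistance_of_properlyInfinite ρ hρ hinf⟩,
    fun n _ ↦ ⟨UniformMetric.isStarProjection_half_one_add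
      (UniformMetric.transposition_mul_transposition n)
      (UniformMetric.isSelfAdjoint_transposition n),
      UniformMetric.inducesNormDistance_transposition n⟩⟩
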